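/- **Lemma 3.5.** For a bounded nonempty set $M\subset\mathbb C$ put $H_M(z)=\sup_{t\in M}\operatorname{Re}(zt)$, and let $\mathbb N=\{1,2,\dots\}$. Let $Q\subset\mathbb C$ be a convex set with nonempty interior which has a countable basis of neighbourhoods consisting of convex domains, and suppose that $\omega:=Q\cap\partial Q\neq\varnothing$. Let $(G_m)_{m\in\mathbb N}$ be a fundamental sequence of compact subsets of $\operatorname{int}Q$ (every compact subset of $\operatorname{int}Q$ is contained in some $G_m$) such that each $G_m$ is convex and $G_m\subset\operatorname{int}G_{m+1}$. For $n,m\in\mathbb N$ put $$H_{nm}:=H_{G_{mn}},\qquad G_{mn}:=\operatorname{conv}\Big(G_m\cup\Big(\omega+\overline B\big(0,\tfrac{m}{n(1+m)}\big)\Big)\Big).$$ Let $K\subset\mathbb C$ be a convex compact set, and let $A(K)$ be the space of germs of functions analytic on $K$, with the locally convex inductive limit topology of the spaces $A(U)$, $U\supset K$ open, where $A(U)$ is the space of functions analytic in $U$ with the topology of uniform convergence on compact sets. Let $\mu\neq0$ be a continuous linear functional on $A(K)$, and let $\widehat\mu(\lambda)=\mu(e_\lambda)$, $e_\lambda(z)=e^{\lambda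 z}$, be its Laplace transform. Suppose that the zero set $V(\widehat\mu)$ of $\widehat\mu$ is infinite, and let $(\Omega_j)_{j\in\mathbb N}$ be a sequence of pairwise disjoint bounded domains in $\mathbb C$ such that for every $n\in\mathbb N$ there is a constant $C>0$ for which, for all $j\in\mathbb N$, * (i) $|\widehat\mu(z)|\ge\exp(H_K(z)-|z|/n-C)$ for $z\in\partial\Omega_j$; * (ii) $\sup_{z,w\in\Omega_j}|z-w|\le\frac1n\inf_{z\in\Omega_j}|z|+C$; * (iii) $\sup_{z\in\Omega_j}H_K(z)\le\inf_{z\in\Omega_j}\big(H_K(z)+|z|/n\big)+C$; and such that, moreover, * (iv) $V(\widehat\mu)\subseteq\bigcup_j\Omega_j$ and $\Omega_j\cap V(\widehat\mu)\ne\varnothing$ for every $j$. Let $A^\infty(\Omega_j)$ be the Banach space of bounded analytic functions on $\Omega_j$ with the supremum norm, and let $E_j:=A^\infty(\Omega_j)/\big(\widehat\mu|_{\Omega_j}\cdot A^\infty(\Omega_j)\big)$ with the quotient norm $\|\cdot\|_j$. Choose $\nu_j\in\Omega_j\cap V(\widehat\mu)$ for each $j$, and put $$\Lambda_m(Q_n,\widehat\mu,\mathbb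 E):=\Big\{X=(x_j)_j\in\prod_{j}E_j:\ |||X|||_{nm}:=\sup_j\frac{\|x_j\|_j}{\exp H_{nm}(\nu_j)}<\infty\Big\},$$ $$\Lambda(Q_n,\widehat\mu,\mathbb E):=\operatorname{ind}_{m\to}\Lambda_m(Q_n,\widehat\mu,\mathbb E),\qquad \Lambda(Q,\widehat\mu,\mathbb E):=\operatorname{proj}_{\leftarrow n}\Lambda(Q_n,\widehat\mu,\mathbb E)$$ (locally convex inductive limit over $m$, projective limit over $n$, with respect to the inclusions). Then the space $\Lambda(Q,\widehat\mu,\mathbb E)$ is ultrabornological, that is, it is the locally convex inductive limit of some family of Banach spaces. -/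

import Mathlib

open Set Filter Topology
open scoped Pointwise

noncomputable section

/-! ### Locally convex inductive limits and ultrabornological spaces -/

/-- The locally convex inductive topology on `F` with respect to linear maps `f i : E i → F`:
the finest locally convex vector space topology for which all `f i` are continuous. (In Mathlib's
order on topologies the infimum of a family is the coarsest topology finer than all its members;
the infimum below is itself a locally convex topology making all `f i` continuous.) -/
@[reducible] def lcInductiveTopology {ι : Type*} {E : ι → Type*} {F : Type*}
    [∀ i, AddCommGroup (E i)] [∀ i, Module ℂ (E i)] [∀ i, TopologicalSpace (E i)]
    [AddCommGroup F] [Module ℂ F] (f : ∀ i, E i →ₗ[ℂ] F) : TopologicalSpace F :=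
  sInf {t : TopologicalSpace F |
    @IsTopologicalAddGroup F t _ ∧ @ContinuousSMul ℂ F _ _ t ∧
    @LocallyConvexSpace ℝ F _ _ _ (Module.complexToReal F) t ∧
    ∀ i, @Continuous (E i) F _ t (f i)}

/-- A topological vector space is ultrabornological if it is the locally convex inductive limit of
some family of (complex) Banach spaces. -/
def IsUltrabornological (F : Type) [AddCommGroup F] [Module ℂ F] [t : TopologicalSpace F] : Prop :=
  ∃ (ι : Type) (B : ι → Type) (_ : ∀ i, NormedAddCommGroup (B i))
    (_ : ∀ i, NormedSpace ℂ (B i)) (_ : ∀ i, CompleteSpace (B i)) (f : ∀ i, B i →ₗ[ℂ] F),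
    (⨆ i, LinearMap.range (f i)) = ⊤ ∧ t = lcInductiveTopology f

/-! ### Germs of analytic functions and analytic functionals -/

/-- `A(U)` for an open set `U`: the functions analytic in `U`, with the topology of uniform
convergence on compact subsets of `U` (the compact-open topology of `C(U, ℂ)`). -/
def AnalyticOnOpen (U : Set ℂ) : Submodule ℂ C(U, ℂ) where
  carrier := {f | ∃ F : ℂ → ℂ, AnalyticOnNhd ℂ F U ∧ ∀ z : U, f z = F z}
  zero_mem' := ⟨0, fun _ _ => analyticAt_const, fun _ => rfl⟩
  add_mem' := by
    rintro f g ⟨F, hF, hf⟩ ⟨G, hG, hg⟩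
    exact ⟨F + G, hF.add hG, fun z => by simp [hf, hg]⟩
  smul_mem' := by
    rintro c f ⟨F, hF, hf⟩
    exact ⟨fun z => c * F z, analyticOnNhd_const.mul hF, fun z => by simp [hf]⟩

/-- The germs on `M` of functions analytic in some neighbourhood of `M`. -/
def analyticGermSubmodule (M : Set ℂ) : Submodule ℂ (Germ (𝓝ˢ M) ℂ) where
  carrier := {g | ∃ F : ℂ → ℂ, AnalyticOnNhd ℂ F M ∧ g = (F : Germ (𝓝ˢ M) ℂ)}
  zero_mem' := ⟨0, fun _ _ => analyticAt_const, rfl⟩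
  add_mem' := by
    rintro f g ⟨F, hF, rfl⟩ ⟨G, hG, rfl⟩
    exact ⟨F + G, hF.add hG, rfl⟩
  smul_mem' := by
    rintro c f ⟨F, hF, rfl⟩
    exact ⟨fun z => c * F z, analyticOnNhd_const.mul hF, rfl⟩

/-- `A(M)`, the space of germs of functions analytic on `M`. -/
def AnalyticGerm (M : Set ℂ) : Type := analyticGermSubmodule M

instance (M : Set ℂ) : AddCommGroup (AnalyticGerm M) :=
  inferInstanceAs (AddCommGroup (analyticGermSubmodule M))

instance (M : Set ℂ) : Module ℂ (AnalyticGerm M) :=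
  inferInstanceAs (Module ℂ (analyticGermSubmodule M))

/-- A function on `U`, extended by zero to the plane. -/
def extendByZero (U : Set ℂ) (f : C(U, ℂ)) : ℂ → ℂ :=
  Function.extend Subtype.val f 0

theorem extendByZero_apply {U : Set ℂ} (f : C(U, ℂ)) {z : ℂ} (hz : z ∈ U) :
    extendByZero U f z = f ⟨z, hz⟩ :=
  Subtype.val_injective.extend_apply f 0 ⟨z, hz⟩

/-- The natural map `A(U) → A(M)` for an open neighbourhood `U` of `M`. -/
def germMap (M U : Set ℂ) (hU : IsOpen U) (hMU : M ⊆ U) :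
    AnalyticOnOpen U →ₗ[ℂ] AnalyticGerm M where
  toFun f := ⟨(extendByZero U f.1 : Germ (𝓝ˢ M) ℂ), extendByZero U f.1, by
    obtain ⟨F, hF, hf⟩ := f.2
    intro z hz
    refine (hF z (hMU hz)).congr ?_
    filter_upwards [hU.mem_nhds (hMU hz)] with w hw
    rw [extendByZero_apply _ hw, hf], rfl⟩
  map_add' f g := by
    refine Subtype.ext (Germ.coe_eq.2 ?_)
    filter_upwards [hU.mem_nhdsSet.2 hMU] with w hw
    simp [extendByZero_apply _ hw]
  map_smul' c f := by
    refine Subtype.ext (Germ.coe_eq.2 ?_)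
    filter_upwards [hU.mem_nhdsSet.2 hMU] with w hw
    simp [extendByZero_apply _ hw]

/-- `A(M)` carries the locally convex inductive limit topology of the spaces `A(U)`, where `U` runs
through the open neighbourhoods of `M`. -/
instance (M : Set ℂ) : TopologicalSpace (AnalyticGerm M) :=
  lcInductiveTopology (ι := {U : Set ℂ // IsOpen U ∧ M ⊆ U})
    (E := fun U => AnalyticOnOpen U.1) (fun U => germMap M U.1 U.2.1 U.2.2)

/-- The germ on `M` of the exponential `e_lam : z ↦ exp (lam z)`. -/
def expGerm (M : Set ℂ) (lam : ℂ) : AnalyticGerm M :=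
  ⟨((fun z => Complex.exp (lam * z) : ℂ → ℂ) : Germ (𝓝ˢ M) ℂ),
    fun z => Complex.exp (lam * z), fun _ _ => by fun_prop, rfl⟩

/-- The Laplace transform `lam ↦ μ (e_lam)` of an analytic functional `μ ∈ A(M)'`. -/
def laplaceTransform {M : Set ℂ} (μ : AnalyticGerm M →L[ℂ] ℂ) (lam : ℂ) : ℂ :=
  μ (expGerm M lam)

/-! ### Geometry of the set `Q` -/

/-- The support function `H_M(z) = sup_{t ∈ M} Re (z t)` (of a bounded nonempty set `M`). -/
def supportFn (M : Set ℂ) (z : ℂ) : ℝ :=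
  sSup ((fun t : ℂ => (z * t).re) '' M)

/-- `Q` has a countable basis of neighbourhoods consisting of convex domains. -/
def HasCountableConvexBasis (Q : Set ℂ) : Prop :=
  ∃ U : ℕ → Set ℂ, (∀ n, IsOpen (U n) ∧ Convex ℝ (U n)) ∧
    (𝓝ˢ Q).HasBasis (fun _ : ℕ => True) U

/-- `G 0, G 1, …` is a fundamental sequence of compact subsets of the open set `D`, consisting of
convex sets, each contained in the interior of the next one. -/
structure IsConvexCompactExhaustion (D : Set ℂ) (G : ℕ → Set ℂ) : Prop where
  isCompact : ∀ m, IsCompact (G m)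
  convex : ∀ m, Convex ℝ (G m)
  subset : ∀ m, G m ⊆ D
  subset_interior_succ : ∀ m, G m ⊆ interior (G (m + 1))
  exhausts : ∀ T : Set ℂ, IsCompact T → T ⊆ D → ∃ m, T ⊆ G m

/-- The compact sets `conv (G_m ∪ (ω + closed ball of radius m / (n (1 + m))))` with
`ω = Q ∩ ∂Q`. As everywhere below, indices are shifted: the natural numbers `n, m = 0, 1, …` stand
for `n + 1, m + 1 = 1, 2, …`. -/
def compactHull (Q : Set ℂ) (G : ℕ → Set ℂ) (n m : ℕ) : Set ℂ :=
  convexHull ℝ (G m ∪ ((Q ∩ frontier Q) +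
    Metric.closedBall (0 : ℂ) (((m : ℝ) + 1) / (((n : ℝ) + 1) * (1 + ((m : ℝ) + 1))))))

/-- The function `H_{nm}`, the support function of the compact set above. -/
def weightFn (Q : Set ℂ) (G : ℕ → Set ℂ) (n m : ℕ) : ℂ → ℝ :=
  supportFn (compactHull Q G n m)

/-! ### Exceptional domains and the spaces `E_j` -/

/-- A sequence of pairwise disjoint bounded domains which cover the zeros of `g`, each containing a
zero, and such that for every `n` the estimates (lower bound for `|g|` on the boundaries, small
diameters, small oscillation of `H_K`) hold with one constant `C` for all the domains. -/
structure IsExceptionalSequence (K : Set ℂ) (g : ℂ → ℂ) (Ω : ℕ → Set ℂ) : Prop where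
  isOpen : ∀ j, IsOpen (Ω j)
  isConnected : ∀ j, IsConnected (Ω j)
  isBounded : ∀ j, Bornology.IsBounded (Ω j)
  disjoint : ∀ i j, i ≠ j → Disjoint (Ω i) (Ω j)
  estimates : ∀ n : ℕ, 1 ≤ n → ∃ C : ℝ, 0 < C ∧ ∀ j,
    (∀ z ∈ frontier (Ω j), Real.exp (supportFn K z - ‖z‖ / n - C) ≤ ‖g z‖) ∧
    (∀ z ∈ Ω j, ∀ w ∈ Ω j, ∀ u ∈ Ω j, ‖z - w‖ ≤ (1 / n) * ‖u‖ + C) ∧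
    (∀ z ∈ Ω j, ∀ u ∈ Ω j, supportFn K z ≤ (supportFn K u + ‖u‖ / n) + C)
  zeros_subset : {z | g z = 0} ⊆ ⋃ j, Ω j
  zero_mem : ∀ j, (Ω j ∩ {z | g z = 0}).Nonempty

/-- `A^∞(Ω)`: the bounded analytic functions on the open set `Ω`, with the supremum norm. -/
def BoundedAnalytic (Ω : Set ℂ) : Submodule ℂ (BoundedContinuousFunction Ω ℂ) where
  carrier := {f | ∃ F : ℂ → ℂ, AnalyticOnNhd ℂ F Ω ∧ ∀ z : Ω, f z = F z}
  zero_mem' := ⟨0, fun _ _ => analyticAt_const, fun _ => rfl⟩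
  add_mem' := by
    rintro f g ⟨F, hF, hf⟩ ⟨G, hG, hg⟩
    exact ⟨F + G, hF.add hG, fun z => by simp [hf, hg]⟩
  smul_mem' := by
    rintro c f ⟨F, hF, hf⟩
    exact ⟨fun z => c * F z, analyticOnNhd_const.mul hF, fun z => by simp [hf]⟩

/-- The ideal `g|_Ω · A^∞(Ω)` of `A^∞(Ω)`. -/
def multiplesIdeal (g : ℂ → ℂ) (Ω : Set ℂ) : Submodule ℂ (BoundedAnalytic Ω) where
  carrier := {f | ∃ q : BoundedAnalytic Ω, ∀ z : Ω, f.1 z = g z * q.1 z}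
  zero_mem' := ⟨0, fun z => by simp⟩
  add_mem' := by
    rintro f₁ f₂ ⟨q₁, h₁⟩ ⟨q₂, h₂⟩
    exact ⟨q₁ + q₂, fun z => by simp [h₁, h₂, mul_add]⟩
  smul_mem' := by
    rintro c f ⟨q, h⟩
    exact ⟨c • q, fun z => by simp [h]; ring⟩

/-- `E = A^∞(Ω) / (g|_Ω · A^∞(Ω))`; Mathlib's quotient norm is the infimum of the supremum norms of
the representatives. -/
abbrev LocalQuotient (g : ℂ → ℂ) (Ω : Set ℂ) : Type :=
  BoundedAnalytic Ω ⧸ multiplesIdeal g Ω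

/-! ### Weighted spaces of vector-valued sequences -/

section Sequences

variable (E : ℕ → Type) [∀ j, SeminormedAddCommGroup (E j)] [∀ j, NormedSpace ℂ (E j)]

/-- The sequences `x` with `x j ∈ E j` and `sup_j ‖x j‖ / exp (h j) < ∞`. -/
def weightedSubmodule (h : ℕ → ℝ) : Submodule ℂ (∀ j, E j) where
  carrier := {x | BddAbove (range fun j => ‖x j‖ / Real.exp (h j))}
  zero_mem' := ⟨0, by rintro _ ⟨j, rfl⟩; simp⟩
  add_mem' := by
    rintro x y ⟨C, hC⟩ ⟨D, hD⟩
    refine ⟨C + D, ?_⟩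
    rintro _ ⟨j, rfl⟩
    have h₁ := hC ⟨j, rfl⟩
    have h₂ := hD ⟨j, rfl⟩
    calc ‖(x + y) j‖ / Real.exp (h j) ≤ (‖x j‖ + ‖y j‖) / Real.exp (h j) := by
          gcongr; exact norm_add_le _ _
      _ = ‖x j‖ / Real.exp (h j) + ‖y j‖ / Real.exp (h j) := add_div _ _ _
      _ ≤ C + D := add_le_add h₁ h₂
  smul_mem' := by
    rintro c x ⟨C, hC⟩
    refine ⟨‖c‖ * C, ?_⟩
    rintro _ ⟨j, rfl⟩
    have h₁ := hC ⟨j, rfl⟩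
    calc ‖(c • x) j‖ / Real.exp (h j) = ‖c‖ * (‖x j‖ / Real.exp (h j)) := by
          rw [Pi.smul_apply, norm_smul, mul_div_assoc]
      _ ≤ ‖c‖ * C := mul_le_mul_of_nonneg_left h₁ (norm_nonneg c)

/-- The space of the sequences `x` with `sup_j ‖x j‖ / exp (h j) < ∞`, as a type of its own, normed
below by this supremum. -/
def WeightedSeq (h : ℕ → ℝ) : Type := weightedSubmodule E h

instance (h : ℕ → ℝ) : AddCommGroup (WeightedSeq E h) :=
  inferInstanceAs (AddCommGroup (weightedSubmodule E h))

instance (h : ℕ → ℝ) : Module ℂ (WeightedSeq E h) :=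
  inferInstanceAs (Module ℂ (weightedSubmodule E h))

/-- The weighted supremum norm `sup_j ‖x j‖ / exp (h j)`. -/
def weightedNorm (h : ℕ → ℝ) : Seminorm ℂ (WeightedSeq E h) :=
  Seminorm.of (fun x => ⨆ j, ‖x.1 j‖ / Real.exp (h j))
    (fun x y => ciSup_le fun j => by
      calc ‖x.1 j + y.1 j‖ / Real.exp (h j) ≤ (‖x.1 j‖ + ‖y.1 j‖) / Real.exp (h j) := by
            gcongr; exact norm_add_le _ _
        _ = ‖x.1 j‖ / Real.exp (h j) + ‖y.1 j‖ / Real.exp (h j) := add_div _ _ _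
        _ ≤ _ := add_le_add (le_ciSup x.2 j) (le_ciSup y.2 j))
    (fun c x => by
      rw [Real.mul_iSup_of_nonneg (norm_nonneg c)]
      refine iSup_congr fun j => ?_
      change ‖c • x.1 j‖ / Real.exp (h j) = _
      rw [norm_smul, mul_div_assoc])

instance (h : ℕ → ℝ) : SeminormedAddCommGroup (WeightedSeq E h) :=
  (weightedNorm E h).toAddGroupSeminorm.toSeminormedAddCommGroup

/-- `ind_m` of the weighted spaces with weights `exp (h m j)`, as a set of sequences: the union (for
weights increasing in `m`) of these spaces. -/
def indSubmodule (h : ℕ → ℕ → ℝ) : Submodule ℂ (∀ j, E j) :=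
  ⨆ m, weightedSubmodule E (h m)

/-- `ind_m` of the weighted spaces with weights `exp (h m j)`, as a type of its own, with the
locally convex inductive limit topology below. -/
def IndWeightedSeq (h : ℕ → ℕ → ℝ) : Type := indSubmodule E h

instance (h : ℕ → ℕ → ℝ) : AddCommGroup (IndWeightedSeq E h) :=
  inferInstanceAs (AddCommGroup (indSubmodule E h))

instance (h : ℕ → ℕ → ℝ) : Module ℂ (IndWeightedSeq E h) :=
  inferInstanceAs (Module ℂ (indSubmodule E h))

/-- The inclusion of the `m`-th weighted space into the inductive limit. -/
def indInclusion (h : ℕ → ℕ → ℝ) (m : ℕ) : WeightedSeq E (h m) →ₗ[ℂ] IndWeightedSeq E h :=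
  Submodule.inclusion (le_iSup (fun m => weightedSubmodule E (h m)) m)

instance (h : ℕ → ℕ → ℝ) : TopologicalSpace (IndWeightedSeq E h) :=
  lcInductiveTopology (E := fun m => WeightedSeq E (h m)) (indInclusion E h)

/-- `proj_n ind_m` of the weighted spaces with weights `exp (h n m j)`, as a set of sequences. -/
def projSubmodule (h : ℕ → ℕ → ℕ → ℝ) : Submodule ℂ (∀ j, E j) :=
  ⨅ n, indSubmodule E (h n)

/-- `proj_n ind_m` of the weighted spaces with weights `exp (h n m j)`, as a type of its own, with
the projective limit topology below. -/
def ProjIndWeightedSeq (h : ℕ → ℕ → ℕ → ℝ) : Type := projSubmodule E h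

instance (h : ℕ → ℕ → ℕ → ℝ) : AddCommGroup (ProjIndWeightedSeq E h) :=
  inferInstanceAs (AddCommGroup (projSubmodule E h))

instance (h : ℕ → ℕ → ℕ → ℝ) : Module ℂ (ProjIndWeightedSeq E h) :=
  inferInstanceAs (Module ℂ (projSubmodule E h))

/-- The inclusion of the projective limit into its `n`-th member. -/
def projInclusion (h : ℕ → ℕ → ℕ → ℝ) (n : ℕ) :
    ProjIndWeightedSeq E h →ₗ[ℂ] IndWeightedSeq E (h n) :=
  Submodule.inclusion (iInf_le (fun n => indSubmodule E (h n)) n)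

instance (h : ℕ → ℕ → ℕ → ℝ) : TopologicalSpace (ProjIndWeightedSeq E h) :=
  ⨅ n, TopologicalSpace.induced (projInclusion E h n) inferInstance

end Sequences

/-- The space `Λ(Q, g, 𝔼) = proj_n ind_m Λ_m(Q_n, g, 𝔼)`, where `𝔼 = (E_j)` is the sequence of the
quotients `E_j = A^∞(Ω_j) / (g A^∞(Ω_j))` and `Λ_m(Q_n, g, 𝔼)` is the space of the sequences
`x_j ∈ E_j` with `sup_j ‖x_j‖ / exp (H_{nm}(ν_j)) < ∞`. -/
abbrev LambdaSpace (Q : Set ℂ) (G : ℕ → Set ℂ) (g : ℂ → ℂ) (Ω : ℕ → Set ℂ) (ν : ℕ → ℂ) : Type :=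
  ProjIndWeightedSeq (fun j => LocalQuotient g (Ω j)) (fun n m j => weightFn Q G n m (ν j))

end

/-! ### Generalities on locally convex topologies -/

/-! The geometry enters through two facts. The set `ω = Q ∩ ∂Q` is bounded, so the hulls have finite
support functions. Moreover, the support function of a hull is the maximum of that of `G_m`, which
does not depend on `n`, and that of a thickening of `ω`, whose radius stays below `1/n`. After
passing from `n` to `2n`, each weight at each `ν_j` is therefore either below the first weight of
level `n`, or below the weights with the same `m` on all levels. This dichotomy is
`IsSplittingWeight`; it is proved in `isSplittingWeight_weightFn`.

The rest concerns sequence spaces. Call a positive sequence `w` bounding if its unit ball `{‖x_j‖ ≤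
w_j}` is bounded in a single step on every level. Each such ball is covered by the image of a ball
of a Banach space of bounded sequences of representatives, and every element lies in one of the
balls. It remains to show that a seminorm `q` bounded on all these balls is continuous
(`continuous_of_bound_isBoundingWeight`).

A diagonal argument bounds `q` on the unit ball of the first step of some level `n`. Splitting the
index set by the dichotomy then bounds `q` on the trace of every step ball of a later level `n'`.
Finally, a coordinatewise partition of unity dominates `q` by a continuous seminorm of that one
inductive limit (`le_indSeminorm_projInclusion`). -/

/-- The topology defined by `p` alone is one of the competitors in the infimum, so the inductive
topology is finer. -/
theorem continuous_seminorm_lcInductiveTopology {ι : Type*} {E : ι → Type*} {F : Type*}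
    [∀ i, AddCommGroup (E i)] [∀ i, Module ℂ (E i)] [∀ i, TopologicalSpace (E i)]
    [AddCommGroup F] [Module ℂ F] (f : ∀ i, E i →ₗ[ℂ] F) (p : Seminorm ℂ F)
    (hp : ∀ i, Tendsto (fun x => p (f i x)) (𝓝 0) (𝓝 0))
    (hE : ∀ i, IsTopologicalAddGroup (E i)) :
    @Continuous F ℝ (lcInductiveTopology f) _ p := by
  let τ : TopologicalSpace F := p.toSeminormedAddCommGroup.toUniformSpace.toTopologicalSpace
  have hg : IsTopologicalAddGroup F :=
    letI := p.toSeminormedAddCommGroup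
    inferInstance
  have hτ : WithSeminorms (fun _ : Unit => p) := by
    rw [SeminormFamily.withSeminorms_iff_topologicalSpace_eq_iInf]
    exact (ciInf_const).symm
  have hle : lcInductiveTopology f ≤ τ := by
    refine sInf_le ⟨hg, hτ.continuousSMul, ?_, fun i => ?_⟩
    · exact hτ.toLocallyConvexSpace
    · have := hE i
      refine WithSeminorms.continuous_of_continuous_comp hτ (f i) fun _ => ?_
      refine Seminorm.continuous_of_continuousAt_zero ?_
      rw [ContinuousAt, map_zero]
      exact hp i
  exact continuous_le_dom hle (hτ.continuous_seminorm ())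

theorem continuous_of_continuous_seminorm_comp {E F : Type*} [AddCommGroup E] [Module ℝ E]
    [TopologicalSpace E] [IsTopologicalAddGroup E] [AddCommGroup F] [Module ℝ F]
    [TopologicalSpace F] [IsTopologicalAddGroup F] [ContinuousSMul ℝ F] [LocallyConvexSpace ℝ F]
    (f : E →ₗ[ℝ] F) (h : ∀ q : Seminorm ℝ F, Continuous q → Continuous (q.comp f)) :
    Continuous f :=
  WithSeminorms.continuous_of_continuous_comp with_gaugeSeminormFamily f
    fun i => h _ (with_gaugeSeminormFamily.continuous_seminorm i)

/-- A locally convex topology is generated by its continuous seminorms, so inclusion of topologies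
can be tested on them. -/
theorem le_of_continuous_seminorm {F : Type*} [AddCommGroup F] [Module ℂ F]
    {t s : TopologicalSpace F} (ht : @IsTopologicalAddGroup F t _)
    (hs : @IsTopologicalAddGroup F s _) (hs' : @ContinuousSMul ℂ F _ _ s)
    (hs'' : @LocallyConvexSpace ℝ F _ _ _ (Module.complexToReal F) s)
    (h : ∀ q : Seminorm ℝ F, @Continuous F ℝ s _ q → @Continuous F ℝ t _ q) : t ≤ s := by
  have hsr : @ContinuousSMul ℝ F _ _ s := 
    @IsScalarTower.continuousSMul ℝ ℂ F _ _ _ _ _ _ _ s _ hs'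
  rw [← continuous_id_iff_le]
  exact @continuous_of_continuous_seminorm_comp F F _ _ t ht _ _ s hs hsr hs'' LinearMap.id h

theorem isTopologicalAddGroup_lcInductiveTopology {ι : Type*} {E : ι → Type*} {F : Type*}
    [∀ i, AddCommGroup (E i)] [∀ i, Module ℂ (E i)] [∀ i, TopologicalSpace (E i)]
    [AddCommGroup F] [Module ℂ F] (f : ∀ i, E i →ₗ[ℂ] F) :
    @IsTopologicalAddGroup F (lcInductiveTopology f) _ :=
  topologicalAddGroup_sInf fun _ ht => ht.1

theorem continuousSMul_lcInductiveTopology {ι : Type*} {E : ι → Type*} {F : Type*}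
    [∀ i, AddCommGroup (E i)] [∀ i, Module ℂ (E i)] [∀ i, TopologicalSpace (E i)]
    [AddCommGroup F] [Module ℂ F] (f : ∀ i, E i →ₗ[ℂ] F) :
    @ContinuousSMul ℂ F _ _ (lcInductiveTopology f) :=
  continuousSMul_sInf fun _ ht => ht.2.1

theorem locallyConvexSpace_lcInductiveTopology {ι : Type*} {E : ι → Type*} {F : Type*}
    [∀ i, AddCommGroup (E i)] [∀ i, Module ℂ (E i)] [∀ i, TopologicalSpace (E i)]
    [AddCommGroup F] [Module ℂ F] (f : ∀ i, E i →ₗ[ℂ] F) :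
    @LocallyConvexSpace ℝ F _ _ _ (Module.complexToReal F) (lcInductiveTopology f) :=
  LocallyConvexSpace.sInf fun _ ht => ht.2.2.1

theorem continuous_lcInductiveTopology {ι : Type*} {E : ι → Type*} {F : Type*}
    [∀ i, AddCommGroup (E i)] [∀ i, Module ℂ (E i)] [∀ i, TopologicalSpace (E i)]
    [AddCommGroup F] [Module ℂ F] (f : ∀ i, E i →ₗ[ℂ] F) (i : ι) :
    @Continuous (E i) F _ (lcInductiveTopology f) (f i) :=
  continuous_sInf_rng.2 fun _ ht => ht.2.2.2 i

/-! ### Weighted sequence spaces -/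

section GaugeSets

variable {E : ℕ → Type} [∀ j, SeminormedAddCommGroup (E j)]

/-- The `r > 0` such that `‖y j‖ ≤ r * ∑ m < N, d m * exp (h m j)` for some `N` and all `j`. -/
def indGaugeSet (h : ℕ → ℕ → ℝ) (d : ℕ → ℝ) (y : ∀ j, E j) : Set ℝ :=
  {r | 0 < r ∧ ∃ N, ∀ j, ‖y j‖ ≤ r * ∑ m ∈ Finset.range N, d m * Real.exp (h m j)}

theorem bddBelow_indGaugeSet (h : ℕ → ℕ → ℝ) (d : ℕ → ℝ) (y : ∀ j, E j) :
    BddBelow (indGaugeSet h d y) :=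
  ⟨0, fun _ hr => hr.1.le⟩

theorem sum_mul_exp_le {h : ℕ → ℕ → ℝ} {d : ℕ → ℝ} (hd : ∀ m, 0 < d m) (j : ℕ) {N M : ℕ}
    (hNM : N ≤ M) : ∑ m ∈ Finset.range N, d m * Real.exp (h m j) ≤
      ∑ m ∈ Finset.range M, d m * Real.exp (h m j) :=
  Finset.sum_le_sum_of_subset_of_nonneg (Finset.range_mono hNM)
    fun i _ _ => mul_nonneg (hd i).le (Real.exp_pos _).le

theorem mem_indGaugeSet_of_norm_le {h : ℕ → ℕ → ℝ} {d : ℕ → ℝ} (hd : ∀ m, 0 < d m)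
    {y : ∀ j, E j} {m : ℕ} {C r : ℝ} (hC : ∀ j, ‖y j‖ ≤ C * Real.exp (h m j)) (hr : 0 < r)
    (hCr : C ≤ r * d m) : r ∈ indGaugeSet h d y := by
  refine ⟨hr, m + 1, fun j => (hC j).trans ?_⟩
  calc C * Real.exp (h m j) ≤ r * d m * Real.exp (h m j) := by gcongr
    _ = r * (d m * Real.exp (h m j)) := mul_assoc _ _ _
    _ ≤ _ := by
        refine mul_le_mul_of_nonneg_left ?_ hr.le
        exact Finset.single_le_sum (f := fun m => d m * Real.exp (h m j))
          (fun i _ => mul_nonneg (hd i).le (Real.exp_pos _).le) (Finset.self_mem_range_succ m)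

theorem indGaugeSet_zero (h : ℕ → ℕ → ℝ) (d : ℕ → ℝ) :
    indGaugeSet h d (0 : ∀ j, E j) = Ioi 0 := by
  ext r
  exact ⟨fun hr => hr.1, fun hr => ⟨hr, 0, fun j => by simp⟩⟩

end GaugeSets

/-! ### Membership in the limits of weighted spaces -/

section WeightedSequences

variable {E : ℕ → Type} [∀ j, SeminormedAddCommGroup (E j)] [∀ j, NormedSpace ℂ (E j)]

theorem mem_weightedSubmodule_iff {h : ℕ → ℝ} {x : ∀ j, E j} :
    x ∈ weightedSubmodule E h ↔ ∃ C : ℝ, ∀ j, ‖x j‖ ≤ C * Real.exp (h j) := by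
  change BddAbove (range fun j => ‖x j‖ / Real.exp (h j)) ↔ _
  simp only [bddAbove_def, forall_mem_range, div_le_iff₀ (Real.exp_pos _)]

theorem WeightedSeq.norm_apply_le {h : ℕ → ℝ} (x : WeightedSeq E h) (j : ℕ) :
    ‖x.1 j‖ ≤ ‖x‖ * Real.exp (h j) := by
  rw [← div_le_iff₀ (Real.exp_pos _)]
  exact le_ciSup x.2 j

theorem WeightedSeq.norm_le {h : ℕ → ℝ} (x : WeightedSeq E h) {C : ℝ}
    (hC : ∀ j, ‖x.1 j‖ ≤ C * Real.exp (h j)) : ‖x‖ ≤ C :=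
  ciSup_le fun j => (div_le_iff₀ (Real.exp_pos _)).2 (hC j)

theorem mem_indSubmodule_iff {h : ℕ → ℕ → ℝ} (hmono : ∀ j, Monotone fun m => h m j)
    {x : ∀ j, E j} :
    x ∈ indSubmodule E h ↔ ∃ (m : ℕ) (C : ℝ), ∀ j, ‖x j‖ ≤ C * Real.exp (h m j) := by
  have hm : Monotone fun m => weightedSubmodule E (h m) := by
    intro m m' hmm x hx
    obtain ⟨C, hC⟩ := mem_weightedSubmodule_iff.1 hx
    refine mem_weightedSubmodule_iff.2 ⟨|C|, fun j => (hC j).trans ?_⟩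
    gcongr
    · exact le_abs_self C
    · exact hmono j hmm
  rw [indSubmodule, Submodule.mem_iSup_of_directed _ hm.directed_le]
  simp only [mem_weightedSubmodule_iff]

theorem mem_projSubmodule_iff {h : ℕ → ℕ → ℕ → ℝ} (hmono : ∀ n j, Monotone fun m => h n m j)
    {x : ∀ j, E j} :
    x ∈ projSubmodule E h ↔
      ∀ n, ∃ (m : ℕ) (C : ℝ), ∀ j, ‖x j‖ ≤ C * Real.exp (h n m j) := by
  simp only [projSubmodule, Submodule.mem_iInf, mem_indSubmodule_iff (hmono _)]

theorem mem_projSubmodule_of_norm_le {h : ℕ → ℕ → ℕ → ℝ}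
    (hmono : ∀ n j, Monotone fun m => h n m j) {x y : ∀ j, E j} (hx : x ∈ projSubmodule E h)
    (hyx : ∀ j, ‖y j‖ ≤ ‖x j‖) : y ∈ projSubmodule E h := by
  rw [mem_projSubmodule_iff hmono] at hx ⊢
  intro n
  obtain ⟨m, C, hC⟩ := hx n
  exact ⟨m, C, fun j => (hyx j).trans (hC j)⟩

/-- The weights `exp (h n m j)` increase in `m`, decrease in `n`, are bounded below by a positive
sequence, and for every `n` there is an `n'` such that each weight with first index `n'` is at each
`j` dominated by the weight with indices `n, 0` or by all weights with the same second index. -/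
structure IsSplittingWeight (h : ℕ → ℕ → ℕ → ℝ) : Prop where
  mono : ∀ n j, Monotone fun m => h n m j
  anti : ∀ m j, Antitone fun n => h n m j
  bounded_below : ∃ L : ℕ → ℝ, ∀ n m j, L j ≤ h n m j
  split : ∀ n, ∃ n', ∀ m j, h n' m j ≤ h n 0 j ∨ ∀ k, h n' m j ≤ h k m j

/-- Positive sequences `w` whose unit ball `{x | ‖x j‖ ≤ w j}` is bounded in `proj_n ind_m`. -/
structure IsBoundingWeight (h : ℕ → ℕ → ℕ → ℝ) (w : ℕ → ℝ) : Prop where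
  pos : ∀ j, 0 < w j
  bound : ∀ n, ∃ (m : ℕ) (C : ℝ), ∀ j, w j ≤ C * Real.exp (h n m j)

/-! ### Bounding weights and seminorms bounded on their balls -/

variable {h : ℕ → ℕ → ℕ → ℝ}

/-- The pointwise supremum works: on level `n` the terms with index at least `n` are controlled by
the first weight, and the finitely many others lie in a common step. -/
theorem exists_isBoundingWeight_of_seq (hh : IsSplittingWeight h)
    (x : ℕ → ProjIndWeightedSeq E h) (hx : ∀ n j, ‖(x n).1 j‖ ≤ Real.exp (h n 0 j)) :
    ∃ w, IsBoundingWeight h w ∧ ∀ n j, ‖(x n).1 j‖ ≤ w j := by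
  obtain ⟨L, hL⟩ := hh.bounded_below
  have hbdd : ∀ j, BddAbove (range fun n => ‖(x n).1 j‖) := fun j => by
    refine ⟨Real.exp (h 0 0 j), ?_⟩
    rintro _ ⟨n, rfl⟩
    exact (hx n j).trans (Real.exp_le_exp.2 (hh.anti 0 j n.zero_le))
  -- The summand `exp (L j)` makes the weight positive and costs nothing, being below every weight.
  refine ⟨fun j => (⨆ n, ‖(x n).1 j‖) + Real.exp (L j), ⟨fun j => ?_, fun n => ?_⟩, fun n j => ?_⟩
  · exact add_pos_of_nonneg_of_pos (Real.iSup_nonneg fun _ => norm_nonneg _) (Real.exp_pos _)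
  · have key : ∀ N, ∃ (m : ℕ) (C : ℝ), 1 ≤ C ∧
        ∀ i < N, ∀ j, ‖(x i).1 j‖ ≤ C * Real.exp (h n m j) := by
      intro N
      induction N with
      | zero => exact ⟨0, 1, le_rfl, fun i hi => absurd hi i.not_lt_zero⟩
      | succ N ih =>
        obtain ⟨m, C, hC1, hC⟩ := ih
        obtain ⟨m', C', hC'⟩ := (mem_projSubmodule_iff hh.mono).1 (x N).2 n
        refine ⟨max m m', max C C', hC1.trans (le_max_left _ _), fun i hi j => ?_⟩
        have h0 : 0 ≤ max C C' := zero_le_one.trans (hC1.trans (le_max_left _ _))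
        rcases Nat.lt_succ_iff_lt_or_eq.1 hi with hi | rfl
        · refine (hC i hi j).trans ?_
          gcongr
          · exact le_max_left _ _
          · exact hh.mono n j (le_max_left _ _)
        · refine (hC' j).trans ?_
          gcongr
          · exact le_max_right _ _
          · exact hh.mono n j (le_max_right _ _)
    obtain ⟨m, C, hC1, hC⟩ := key n
    refine ⟨m, C + 1, fun j => ?_⟩
    rw [add_mul, one_mul]
    refine add_le_add (ciSup_le fun i => ?_) (Real.exp_le_exp.2 (hL _ _ _))
    rcases lt_or_ge i n with hi | hi
    · exact hC i hi j
    · calc ‖(x i).1 j‖ ≤ Real.exp (h i 0 j) := hx i j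
        _ ≤ Real.exp (h n m j) :=
          Real.exp_le_exp.2 ((hh.anti 0 j hi).trans (hh.mono n j m.zero_le))
        _ ≤ C * Real.exp (h n m j) := le_mul_of_one_le_left (Real.exp_pos _).le hC1
  · exact (le_ciSup (hbdd j) n).trans (le_add_of_nonneg_right (Real.exp_pos _).le)

theorem exists_isBoundingWeight (hh : IsSplittingWeight h) (x : ProjIndWeightedSeq E h) :
    ∃ w, IsBoundingWeight h w ∧ ∀ j, ‖x.1 j‖ ≤ w j := by
  obtain ⟨L, hL⟩ := hh.bounded_below
  refine ⟨fun j => ‖x.1 j‖ + Real.exp (L j), ⟨fun j => by positivity, fun n => ?_⟩,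
    fun j => le_add_of_nonneg_right (Real.exp_pos _).le⟩
  obtain ⟨m, C, hC⟩ := (mem_projSubmodule_iff hh.mono).1 x.2 n
  refine ⟨m, C + 1, fun j => ?_⟩
  rw [add_mul, one_mul]
  exact add_le_add (hC j) (Real.exp_le_exp.2 (hL _ _ _))

theorem isBoundingWeight_iInf (hh : IsSplittingWeight h) (m : ℕ) :
    IsBoundingWeight h fun j => ⨅ k, Real.exp (h k m j) := by
  obtain ⟨L, hL⟩ := hh.bounded_below
  refine ⟨fun j => (Real.exp_pos (L j)).trans_le
    (le_ciInf fun k => Real.exp_le_exp.2 (hL _ _ _)), fun n => ⟨m, 1, fun j => ?_⟩⟩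
  rw [one_mul]
  exact ciInf_le ⟨0, by rintro _ ⟨k, rfl⟩; exact (Real.exp_pos _).le⟩ n

variable {q : Seminorm ℝ (ProjIndWeightedSeq E h)}

/-- Diagonal argument: otherwise some `x n` in the ball of level `n` has `q (x n) > n`, yet one
bounding weight dominates all of them. -/
theorem exists_bound_of_isBoundingWeight (hh : IsSplittingWeight h)
    (hq : ∀ w, IsBoundingWeight h w →
      ∃ C, ∀ x : ProjIndWeightedSeq E h, (∀ j, ‖x.1 j‖ ≤ w j) → q x ≤ C) :
    ∃ (n : ℕ) (C : ℝ), ∀ x : ProjIndWeightedSeq E h,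
      (∀ j, ‖x.1 j‖ ≤ Real.exp (h n 0 j)) → q x ≤ C := by
  by_contra! hcon
  choose x hx hqx using fun n : ℕ => hcon n n
  obtain ⟨w, hw, hxw⟩ := exists_isBoundingWeight_of_seq hh x hx
  obtain ⟨C, hC⟩ := hq w hw
  obtain ⟨n, hn⟩ := exists_nat_gt C
  exact (hn.trans (hqx n)).not_ge (hC (x n) (hxw n))

/-- The dichotomy cuts `x` into two sequences with complementary supports: one lies in the first
ball of level `n`, the other in the ball of the bounding weight `⨅ k, exp (h k m j)`. -/
theorem exists_forall_bound_of_isBoundingWeight (hh : IsSplittingWeight h)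
    (hq : ∀ w, IsBoundingWeight h w →
      ∃ C, ∀ x : ProjIndWeightedSeq E h, (∀ j, ‖x.1 j‖ ≤ w j) → q x ≤ C) :
    ∃ n : ℕ, ∀ m : ℕ, ∃ C : ℝ, ∀ x : ProjIndWeightedSeq E h,
      (∀ j, ‖x.1 j‖ ≤ Real.exp (h n m j)) → q x ≤ C := by
  classical
  obtain ⟨n, C₁, hC₁⟩ := exists_bound_of_isBoundingWeight hh hq
  obtain ⟨n', hn'⟩ := hh.split n
  refine ⟨n', fun m => ?_⟩
  obtain ⟨C₂, hC₂⟩ := hq _ (isBoundingWeight_iInf hh m)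
  refine ⟨C₁ + C₂, fun x hx => ?_⟩
  let y : ProjIndWeightedSeq E h := ⟨fun j => if h n' m j ≤ h n 0 j then x.1 j else 0,
    mem_projSubmodule_of_norm_le hh.mono x.2 fun j => by split_ifs <;> simp⟩
  let z : ProjIndWeightedSeq E h := ⟨fun j => if h n' m j ≤ h n 0 j then 0 else x.1 j,
    mem_projSubmodule_of_norm_le hh.mono x.2 fun j => by split_ifs <;> simp⟩
  have hxyz : x = y + z := Subtype.ext <| funext fun j => by
    change x.1 j = (if h n' m j ≤ h n 0 j then x.1 j else 0) +
      (if h n' m j ≤ h n 0 j then 0 else x.1 j)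
    split_ifs <;> simp
  rw [hxyz]
  refine (map_add_le_add q y z).trans (add_le_add (hC₁ y fun j => ?_) (hC₂ z fun j => ?_))
  · change ‖if h n' m j ≤ h n 0 j then x.1 j else 0‖ ≤ _
    split_ifs with hj
    · exact (hx j).trans (Real.exp_le_exp.2 hj)
    · rw [norm_zero]; exact (Real.exp_pos _).le
  · change ‖if h n' m j ≤ h n 0 j then 0 else x.1 j‖ ≤ _
    split_ifs with hj
    · rw [norm_zero]; exact ((isBoundingWeight_iInf hh m).pos j).le
    · exact le_ciInf fun k => (hx j).trans
        (Real.exp_le_exp.2 (((hn' m j).resolve_left hj) k))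

/-! ### Continuous gauges on the inductive limit -/

theorem indGaugeSet_nonempty {h : ℕ → ℕ → ℝ} (hmono : ∀ j, Monotone fun m => h m j)
    {d : ℕ → ℝ} (hd : ∀ m, 0 < d m) {y : ∀ j, E j} (hy : y ∈ indSubmodule E h) :
    (indGaugeSet h d y).Nonempty := by
  obtain ⟨m, C, hC⟩ := (mem_indSubmodule_iff hmono).1 hy
  refine ⟨(|C| + 1) / d m,
    mem_indGaugeSet_of_norm_le hd hC (div_pos (by positivity) (hd m)) ?_⟩
  rw [div_mul_cancel₀ _ (hd m).ne']
  linarith [le_abs_self C]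

/-- The gauge on `ind_m` of the union over `N` of the sets
`{y | ‖y j‖ ≤ ∑ m < N, d m * exp (h m j) for all j}`. -/
noncomputable def indSeminorm (E : ℕ → Type) [∀ j, SeminormedAddCommGroup (E j)]
    [∀ j, NormedSpace ℂ (E j)] {h : ℕ → ℕ → ℝ} (hmono : ∀ j, Monotone fun m => h m j)
    {d : ℕ → ℝ} (hd : ∀ m, 0 < d m) : Seminorm ℂ (IndWeightedSeq E h) :=
  have h0 : sInf (indGaugeSet h d (0 : ∀ j, E j)) = 0 := by
    rw [indGaugeSet_zero, csInf_Ioi]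
  Seminorm.ofSMulLE (fun y => sInf (indGaugeSet h d y.1)) h0
    (fun x y => by
      have hx := indGaugeSet_nonempty hmono hd x.2
      have hy := indGaugeSet_nonempty hmono hd y.2
      rw [← csInf_add hx (bddBelow_indGaugeSet _ _ _) hy (bddBelow_indGaugeSet _ _ _)]
      refine csInf_le_csInf (bddBelow_indGaugeSet _ _ _) (hx.add hy) ?_
      rintro _ ⟨r, ⟨hr, N, hN⟩, s, ⟨hs, M, hM⟩, rfl⟩
      refine ⟨add_pos hr hs, max N M, fun j => ?_⟩
      calc ‖x.1 j + y.1 j‖ ≤ ‖x.1 j‖ + ‖y.1 j‖ := norm_add_le _ _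
        _ ≤ _ := add_le_add (hN j) (hM j)
        _ ≤ _ := by
          rw [add_mul]
          exact add_le_add
            (mul_le_mul_of_nonneg_left (sum_mul_exp_le hd j (le_max_left _ _)) hr.le)
            (mul_le_mul_of_nonneg_left (sum_mul_exp_le hd j (le_max_right _ _)) hs.le))
    (fun c y => by
      rcases eq_or_ne c 0 with rfl | hc
      · rw [zero_smul, norm_zero, zero_mul]
        exact h0.le
      · rw [← smul_eq_mul, ← Real.sInf_smul_of_nonneg (norm_nonneg c)]
        refine csInf_le_csInf (bddBelow_indGaugeSet _ _ _)
          (indGaugeSet_nonempty hmono hd y.2).smul_set ?_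
        rintro _ ⟨r, ⟨hr, N, hN⟩, rfl⟩
        refine ⟨mul_pos (norm_pos_iff.2 hc) hr, N, fun j => ?_⟩
        change ‖c • y.1 j‖ ≤ ‖c‖ * r * _
        rw [norm_smul, mul_assoc]
        exact mul_le_mul_of_nonneg_left (hN j) (norm_nonneg c))

theorem indSeminorm_indInclusion_le {h : ℕ → ℕ → ℝ} (hmono : ∀ j, Monotone fun m => h m j)
    {d : ℕ → ℝ} (hd : ∀ m, 0 < d m) (m : ℕ) (y : WeightedSeq E (h m)) :
    indSeminorm E hmono hd (indInclusion E h m y) ≤ ‖y‖ / d m := by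
  refine le_of_forall_gt_imp_ge_of_dense fun r hr => csInf_le (bddBelow_indGaugeSet _ _ _) ?_
  exact mem_indGaugeSet_of_norm_le hd (fun j => y.norm_apply_le j)
    ((div_nonneg (norm_nonneg y) (hd m).le).trans_lt hr) ((div_lt_iff₀ (hd m)).1 hr).le

theorem continuous_indSeminorm {h : ℕ → ℕ → ℝ} (hmono : ∀ j, Monotone fun m => h m j)
    {d : ℕ → ℝ} (hd : ∀ m, 0 < d m) : Continuous (indSeminorm E hmono hd) := by
  refine continuous_seminorm_lcInductiveTopology (indInclusion E h) _ (fun m => ?_)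
    fun m => inferInstance
  refine squeeze_zero (fun y => apply_nonneg _ _)
    (fun y => indSeminorm_indInclusion_le hmono hd m y) ?_
  have : Tendsto (fun y : WeightedSeq E (h m) => ‖y‖ / d m) (𝓝 0)
      (𝓝 (‖(0 : WeightedSeq E (h m))‖ / d m)) :=
    (continuous_norm.div_const _).tendsto _
  rwa [norm_zero, zero_div] at this

theorem sum_pow_half_succ_le_one (N : ℕ) :
    ∑ m ∈ Finset.range N, (1 / 2 : ℝ) ^ (m + 1) ≤ 1 := by
  have : ∑ m ∈ Finset.range N, (1 / 2 : ℝ) ^ (m + 1) = 1 - (1 / 2) ^ N := by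
    induction N with
    | zero => simp
    | succ N ih => rw [Finset.sum_range_succ, ih]; ring
  rw [this]
  have : (0 : ℝ) ≤ (1 / 2) ^ N := by positivity
  linarith

/-- If `x` is dominated by `r` times a finite sum of weights, distributing each coordinate in
proportion to the summands splits `x` into pieces dominated by the single summands. Each piece is
`x` multiplied by factors in `[0, 1]`, so it stays in the projective limit, where `q` is defined,
and the bounds add up to at most `r`. -/
theorem le_indSeminorm_projInclusion (hmono : ∀ n j, Monotone fun m => h n m j) (n : ℕ)
    {d : ℕ → ℝ} (hd : ∀ m, 0 < d m)
    (hq : ∀ m, ∀ x : ProjIndWeightedSeq E h,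
      (∀ j, ‖x.1 j‖ ≤ d m * Real.exp (h n m j)) → q x ≤ (1 / 2) ^ (m + 1))
    (x : ProjIndWeightedSeq E h) :
    q x ≤ indSeminorm E (hmono n) hd (projInclusion E h n x) := by
  refine le_csInf (indGaugeSet_nonempty (hmono n) hd
    ((mem_indSubmodule_iff (hmono n)).2 ((mem_projSubmodule_iff hmono).1 x.2 n))) ?_
  rintro r ⟨hr, N, hN⟩
  let e : ℕ → ℕ → ℝ := fun m j => d m * Real.exp (h n m j)
  have he : ∀ m j, 0 < e m j := fun m j => mul_pos (hd m) (Real.exp_pos _)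
  -- Summing up to `N + 1` keeps `σ` positive even when `N = 0`.
  let σ : ℕ → ℝ := fun j => ∑ m ∈ Finset.range (N + 1), e m j
  have hσ : ∀ j, 0 < σ j := fun j =>
    Finset.sum_pos (fun m _ => he m j) (Finset.nonempty_range_iff.2 N.succ_ne_zero)
  have hxσ : ∀ j, ‖x.1 j‖ ≤ r * σ j := fun j => (hN j).trans <|
    mul_le_mul_of_nonneg_left (sum_mul_exp_le hd j N.le_succ) hr.le
  have hnorm : ∀ m j, ‖((e m j / σ j : ℝ) : ℂ) • x.1 j‖ = e m j / σ j * ‖x.1 j‖ := fun m j => by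
    rw [norm_smul, Complex.norm_real, Real.norm_of_nonneg (div_pos (he m j) (hσ j)).le]
  -- The factor `e m j / σ j` is known to be at most `1` only for summands of `σ`; the value `0`
  -- elsewhere is never used.
  let z : ℕ → ProjIndWeightedSeq E h := fun m =>
    if hm : m ∈ Finset.range (N + 1) then
      ⟨fun j => ((e m j / σ j : ℝ) : ℂ) • x.1 j, mem_projSubmodule_of_norm_le hmono x.2 fun j => by
        rw [hnorm]
        refine mul_le_of_le_one_left (norm_nonneg _) ((div_le_one (hσ j)).2 ?_)
        exact Finset.single_le_sum (f := fun m => e m j) (fun i _ => (he i j).le) hm⟩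
    else 0
  have hz : ∀ m ∈ Finset.range (N + 1), ∀ j, (z m).1 j = ((e m j / σ j : ℝ) : ℂ) • x.1 j :=
    fun m hm j => by
      rw [show z m = _ from dif_pos hm]
  have hxz : x = ∑ m ∈ Finset.range (N + 1), z m := by
    refine Subtype.ext (funext fun j => ?_)
    let ev : ProjIndWeightedSeq E h →+ E j := ⟨⟨fun y => y.1 j, rfl⟩, fun _ _ => rfl⟩
    change ev x = ev (∑ m ∈ Finset.range (N + 1), z m)
    rw [map_sum]
    change x.1 j = ∑ m ∈ Finset.range (N + 1), (z m).1 j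
    rw [Finset.sum_congr rfl fun m hm => hz m hm j, ← Finset.sum_smul, ← Complex.ofReal_sum,
      ← Finset.sum_div, div_self (hσ j).ne', Complex.ofReal_one, one_smul]
  have hqz : ∀ m ∈ Finset.range (N + 1), q (z m) ≤ r * (1 / 2) ^ (m + 1) := fun m hm => by
    have h1 : q (r⁻¹ • z m) ≤ (1 / 2) ^ (m + 1) := hq m _ fun j => by
      change ‖((r⁻¹ : ℝ) : ℂ) • (z m).1 j‖ ≤ e m j
      rw [norm_smul, hz m hm, hnorm, Complex.norm_real, Real.norm_of_nonneg (inv_pos.2 hr).le]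
      calc r⁻¹ * (e m j / σ j * ‖x.1 j‖) ≤ r⁻¹ * (e m j / σ j * (r * σ j)) := by
            have := he m j
            have := hσ j
            gcongr
            exact hxσ j
        _ = e m j := by
            have := (hσ j).ne'
            field_simp
    rw [map_smul_eq_mul, Real.norm_of_nonneg (inv_pos.2 hr).le] at h1
    rwa [inv_mul_le_iff₀ hr] at h1
  calc q x ≤ ∑ m ∈ Finset.range (N + 1), q (z m) := by
        conv_lhs => rw [hxz]
        exact Finset.le_sum_of_subadditive q (map_zero q).le (map_add_le_add q) _ _
    _ ≤ ∑ m ∈ Finset.range (N + 1), r * (1 / 2) ^ (m + 1) := Finset.sum_le_sum hqz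
    _ ≤ r := by
        rw [← Finset.mul_sum]
        exact mul_le_of_le_one_right hr.le (sum_pow_half_succ_le_one _)

/-! ### The projective topology and continuity of seminorms -/

theorem continuous_projInclusion (n : ℕ) : Continuous (projInclusion E h n) :=
  continuous_iInf_dom continuous_induced_dom

theorem isTopologicalAddGroup_projIndWeightedSeq :
    IsTopologicalAddGroup (ProjIndWeightedSeq E h) :=
  topologicalAddGroup_iInf fun n =>
    @topologicalAddGroup_induced _ _ _ _ (isTopologicalAddGroup_lcInductiveTopology _) _ _ _ _
      (projInclusion E h n)

theorem continuousSMul_projIndWeightedSeq : ContinuousSMul ℂ (ProjIndWeightedSeq E h) :=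
  continuousSMul_iInf fun n =>
    have : ContinuousSMul ℂ (IndWeightedSeq E (h n)) := continuousSMul_lcInductiveTopology _
    continuousSMul_induced (projInclusion E h n)

theorem locallyConvexSpace_projIndWeightedSeq : LocallyConvexSpace ℝ (ProjIndWeightedSeq E h) :=
  LocallyConvexSpace.iInf fun n =>
    @LocallyConvexSpace.induced _ _ _ _ _ _ _ _ _ _ (locallyConvexSpace_lcInductiveTopology _)
      ((projInclusion E h n).restrictScalars ℝ)

/-- A seminorm on `proj_n ind_m` which is bounded on the unit balls of all bounding weights is
continuous. -/
theorem continuous_of_bound_isBoundingWeight (hh : IsSplittingWeight h)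
    (hq : ∀ w, IsBoundingWeight h w →
      ∃ C, ∀ x : ProjIndWeightedSeq E h, (∀ j, ‖x.1 j‖ ≤ w j) → q x ≤ C) :
    Continuous q := by
  obtain ⟨n, hn⟩ := exists_forall_bound_of_isBoundingWeight hh hq
  choose C hC using hn
  -- Scaling the `m`-th ball by `d m` brings `q` below `(1 / 2) ^ (m + 1)` there; the maximum with
  -- `1` keeps the divisor positive.
  let d : ℕ → ℝ := fun m => (1 / 2) ^ (m + 1) / max 1 (C m)
  have hC1 : ∀ m, 0 < max 1 (C m) := fun m => zero_lt_one.trans_le (le_max_left _ _)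
  have hd : ∀ m, 0 < d m := fun m => div_pos (by positivity) (hC1 m)
  have hle : ∀ x, q x ≤ indSeminorm E (hh.mono n) hd (projInclusion E h n x) := by
    refine le_indSeminorm_projInclusion hh.mono n hd fun m x hx => ?_
    have h1 : q ((d m)⁻¹ • x) ≤ max 1 (C m) := (hC m _ fun j => by
      change ‖(((d m)⁻¹ : ℝ) : ℂ) • x.1 j‖ ≤ _
      rw [norm_smul, Complex.norm_real, Real.norm_of_nonneg (inv_pos.2 (hd m)).le,
        inv_mul_le_iff₀ (hd m)]
      exact hx j).trans (le_max_right _ _)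
    rw [map_smul_eq_mul, Real.norm_of_nonneg (inv_pos.2 (hd m)).le, inv_mul_le_iff₀ (hd m)] at h1
    exact h1.trans_eq (div_mul_cancel₀ _ (hC1 m).ne')
  have := isTopologicalAddGroup_projIndWeightedSeq (E := E) (h := h)
  let p : Seminorm ℝ (ProjIndWeightedSeq E h) :=
    ((indSeminorm E (hh.mono n) hd).comp (projInclusion E h n)).restrictScalars ℝ
  have hp : Continuous p :=
    (continuous_indSeminorm (hh.mono n) hd).comp (continuous_projInclusion n)
  exact Seminorm.continuous_of_le hp hle

/-! ### Banach spaces generating the projective limit -/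

variable {F : ℕ → Type} [∀ j, NormedAddCommGroup (F j)] [∀ j, NormedSpace ℂ (F j)]

theorem mul_norm_apply_le {w : ℕ → ℝ} (hw : ∀ j, 0 < w j) {π : ∀ j, F j →ₗ[ℂ] E j}
    (hπ : ∀ j f, ‖π j f‖ ≤ ‖f‖) (f : lp F ⊤) (j : ℕ) :
    ‖((w j : ℝ) : ℂ) • π j (f j)‖ ≤ w j * ‖f‖ := by
  rw [norm_smul, Complex.norm_real, Real.norm_of_nonneg (hw j).le]
  exact mul_le_mul_of_nonneg_left
    ((hπ j _).trans (lp.norm_apply_le_norm ENNReal.top_ne_zero f j)) (hw j).le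

/-- The map `(f j) ↦ (w j • π j (f j))` from bounded sequences to the projective limit. -/
noncomputable def boundedSeqMap (hmono : ∀ n j, Monotone fun m => h n m j) {w : ℕ → ℝ}
    (hw : IsBoundingWeight h w) {π : ∀ j, F j →ₗ[ℂ] E j} (hπ : ∀ j f, ‖π j f‖ ≤ ‖f‖) :
    lp F ⊤ →ₗ[ℂ] ProjIndWeightedSeq E h where
  toFun f := ⟨fun j => ((w j : ℝ) : ℂ) • π j (f j), (mem_projSubmodule_iff hmono).2 fun n => by
    obtain ⟨m, C, hC⟩ := hw.bound n
    refine ⟨m, C * ‖f‖, fun j => (mul_norm_apply_le hw.pos hπ f j).trans ?_⟩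
    calc w j * ‖f‖ ≤ C * Real.exp (h n m j) * ‖f‖ :=
          mul_le_mul_of_nonneg_right (hC j) (norm_nonneg f)
      _ = _ := by ring⟩
  map_add' f g := Subtype.ext <| funext fun j => by
    change ((w j : ℝ) : ℂ) • π j (f j + g j) =
      ((w j : ℝ) : ℂ) • π j (f j) + ((w j : ℝ) : ℂ) • π j (g j)
    rw [map_add, smul_add]
  map_smul' c f := Subtype.ext <| funext fun j => by
    change ((w j : ℝ) : ℂ) • π j (c • f j) = c • (((w j : ℝ) : ℂ) • π j (f j))
    rw [map_smul, smul_comm]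

/-- On each level `n` the map factors through one weighted space, where it is bounded by the
constant of `w`. -/
theorem continuous_boundedSeqMap (hmono : ∀ n j, Monotone fun m => h n m j) {w : ℕ → ℝ}
    (hw : IsBoundingWeight h w) {π : ∀ j, F j →ₗ[ℂ] E j} (hπ : ∀ j f, ‖π j f‖ ≤ ‖f‖) :
    Continuous (boundedSeqMap hmono hw hπ) := by
  refine continuous_iInf_rng.2 fun n => continuous_induced_rng.2 ?_
  obtain ⟨m, C, hC⟩ := hw.bound n
  have hb : ∀ (f : lp F ⊤) j,
      ‖((w j : ℝ) : ℂ) • π j (f j)‖ ≤ C * ‖f‖ * Real.exp (h n m j) := fun f j =>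
    calc _ ≤ w j * ‖f‖ := mul_norm_apply_le hw.pos hπ f j
      _ ≤ C * Real.exp (h n m j) * ‖f‖ := mul_le_mul_of_nonneg_right (hC j) (norm_nonneg f)
      _ = _ := by ring
  let g : lp F ⊤ →+ WeightedSeq E (h n m) :=
    { toFun := fun f => ⟨fun j => ((w j : ℝ) : ℂ) • π j (f j),
        mem_weightedSubmodule_iff.2 ⟨C * ‖f‖, hb f⟩⟩
      map_zero' := Subtype.ext <| funext fun j => by
        change ((w j : ℝ) : ℂ) • π j 0 = 0
        rw [map_zero, smul_zero]
      map_add' := fun f f' => Subtype.ext <| funext fun j => by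
        change ((w j : ℝ) : ℂ) • π j (f j + f' j) =
          ((w j : ℝ) : ℂ) • π j (f j) + ((w j : ℝ) : ℂ) • π j (f' j)
        rw [map_add, smul_add] }
  have hg : Continuous g :=
    AddMonoidHomClass.continuous_of_bound g C fun f => WeightedSeq.norm_le (g f) (hb f)
  exact (continuous_lcInductiveTopology (indInclusion E (h n)) m).comp hg

theorem exists_boundedSeqMap_eq (hmono : ∀ n j, Monotone fun m => h n m j) {w : ℕ → ℝ}
    (hw : IsBoundingWeight h w) {π : ∀ j, F j →ₗ[ℂ] E j} (hπ : ∀ j f, ‖π j f‖ ≤ ‖f‖)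
    (hlift : ∀ j x (ε : ℝ), 0 < ε → ∃ f, π j f = x ∧ ‖f‖ < ‖x‖ + ε)
    {x : ProjIndWeightedSeq E h} (hx : ∀ j, ‖x.1 j‖ ≤ w j) :
    ∃ f : lp F ⊤, ‖f‖ ≤ 2 ∧ boundedSeqMap hmono hw hπ f = x := by
  have hw0 : ∀ j, ((w j : ℝ) : ℂ) ≠ 0 := fun j => Complex.ofReal_ne_zero.2 (hw.pos j).ne'
  -- The rescaled coordinates have norm at most `1`; lifting with slack `1` gives the uniform bound
  -- `2`.
  choose f hf hfn using fun j => hlift j (((w j : ℝ) : ℂ)⁻¹ • x.1 j) 1 one_pos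
  have hfn' : ∀ j, ‖f j‖ ≤ 2 := fun j => by
    refine (hfn j).le.trans ?_
    rw [norm_smul, norm_inv, Complex.norm_real, Real.norm_of_nonneg (hw.pos j).le]
    have : (w j)⁻¹ * ‖x.1 j‖ ≤ 1 := by
      rw [inv_mul_le_iff₀ (hw.pos j), mul_one]
      exact hx j
    linarith
  refine ⟨⟨f, memℓp_infty ⟨2, by rintro _ ⟨j, rfl⟩; exact hfn' j⟩⟩,
    lp.norm_le_of_forall_le two_pos.le hfn', Subtype.ext <| funext fun j => ?_⟩
  change ((w j : ℝ) : ℂ) • π j (f j) = x.1 j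
  rw [hf, smul_smul, mul_inv_cancel₀ (hw0 j), one_smul]

/-- The projective limit of the inductive limits of weighted spaces of sequences with values in
quotients of Banach spaces is ultrabornological for splitting weights. -/
theorem isUltrabornological_projIndWeightedSeq [∀ j, CompleteSpace (F j)]
    (hh : IsSplittingWeight h) (π : ∀ j, F j →ₗ[ℂ] E j) (hπ : ∀ j f, ‖π j f‖ ≤ ‖f‖)
    (hlift : ∀ j x (ε : ℝ), 0 < ε → ∃ f, π j f = x ∧ ‖f‖ < ‖x‖ + ε) :
    IsUltrabornological (ProjIndWeightedSeq E h) := by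
  -- The Banach spaces consist of sequences of representatives in `F j`, since the quotients `E j`
  -- are only assumed seminormed. The same space serves every `w`; only the map depends on it.
  refine ⟨{w : ℕ → ℝ // IsBoundingWeight h w}, fun _ => lp F ⊤, fun _ => inferInstance,
    fun _ => inferInstance, fun _ => inferInstance, fun w => boundedSeqMap hh.mono w.2 hπ,
    ?_, le_antisymm ?_ ?_⟩
  · refine eq_top_iff.2 fun x _ => ?_
    obtain ⟨w, hw, hxw⟩ := exists_isBoundingWeight hh x
    obtain ⟨f, -, hf⟩ := exists_boundedSeqMap_eq hh.mono hw hπ hlift hxw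
    exact Submodule.mem_iSup_of_mem ⟨w, hw⟩ ⟨f, hf⟩
  -- For a competing topology `s`, an `s`-continuous seminorm is bounded on the image of each Banach
  -- ball, hence on the ball of every bounding weight, hence continuous.
  · refine le_sInf fun s hs => ?_
    obtain ⟨hs1, hs2, hs3, hs4⟩ := hs
    refine le_of_continuous_seminorm isTopologicalAddGroup_projIndWeightedSeq hs1 hs2 hs3
      fun q hq => continuous_of_bound_isBoundingWeight hh fun w hw => ?_
    have hc : Continuous fun f => q (boundedSeqMap hh.mono hw hπ f) :=
      @Continuous.comp _ _ _ _ s _ _ _ hq (hs4 ⟨w, hw⟩)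
    have h0 : ∀ᶠ f in 𝓝 (0 : lp F ⊤), q (boundedSeqMap hh.mono hw hπ f) < 1 := by
      refine hc.continuousAt.eventually_lt_const ?_
      change q (boundedSeqMap hh.mono hw hπ 0) < 1
      rw [map_zero, map_zero]
      exact one_pos
    obtain ⟨ε, hε, hball⟩ := Metric.eventually_nhds_iff.1 h0
    -- A preimage has norm at most `2`, so multiplying it by `ε / 4` puts it inside the `ε`-ball,
    -- where `q < 1`.
    refine ⟨4 / ε, fun x hx => ?_⟩
    obtain ⟨f, hf2, rfl⟩ := exists_boundedSeqMap_eq hh.mono hw hπ hlift hx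
    have h1 : q (boundedSeqMap hh.mono hw hπ (((ε / 4 : ℝ) : ℂ) • f)) < 1 := by
      refine hball ?_
      rw [dist_zero_right, norm_smul, Complex.norm_real, Real.norm_of_nonneg (by positivity)]
      nlinarith
    rw [map_smul] at h1
    change q ((ε / 4 : ℝ) • boundedSeqMap hh.mono hw hπ f) < 1 at h1
    rw [map_smul_eq_mul, Real.norm_of_nonneg (by positivity)] at h1
    rw [le_div_iff₀ hε]
    linarith
  · exact sInf_le ⟨isTopologicalAddGroup_projIndWeightedSeq, continuousSMul_projIndWeightedSeq,
      locallyConvexSpace_projIndWeightedSeq, fun w => continuous_boundedSeqMap hh.mono w.2 hπ⟩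

end WeightedSequences

/-! ### Completeness of the spaces of bounded analytic functions -/

/-- Uniform limits of holomorphic functions on an open set are holomorphic. -/
theorem isClosed_boundedAnalytic {Ω : Set ℂ} (hΩ : IsOpen Ω) :
    IsClosed (BoundedAnalytic Ω : Set (BoundedContinuousFunction Ω ℂ)) := by
  refine IsSeqClosed.isClosed fun u f hu huf => ?_
  choose F hF huF using hu
  refine ⟨Function.extend Subtype.val f 0, DifferentiableOn.analyticOnNhd ?_ hΩ,
    fun z => (Subtype.val_injective.extend_apply f 0 z).symm⟩
  have hunif : TendstoUniformlyOn F (Function.extend Subtype.val f 0) atTop Ω := by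
    rw [Metric.tendstoUniformlyOn_iff]
    intro ε hε
    filter_upwards [Metric.tendsto_nhds.1 huf ε hε] with n hn z hz
    rw [Subtype.val_injective.extend_apply f 0 ⟨z, hz⟩, ← huF n ⟨z, hz⟩, dist_comm]
    exact (BoundedContinuousFunction.dist_coe_le_dist _).trans_lt hn
  exact hunif.tendstoLocallyUniformlyOn.differentiableOn
    (Eventually.of_forall fun n => (hF n).differentiableOn) hΩ

theorem completeSpace_boundedAnalytic {Ω : Set ℂ} (hΩ : IsOpen Ω) :
    CompleteSpace (BoundedAnalytic Ω) :=
  (isClosed_boundedAnalytic hΩ).completeSpace_coe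

/-! ### Support functions and the weights `H_{nm}` -/

theorem bddAbove_re_mul_image {S : Set ℂ} (hS : Bornology.IsBounded S) (z : ℂ) :
    BddAbove ((fun t : ℂ => (z * t).re) '' S) := by
  obtain ⟨R, hR⟩ := hS.exists_norm_le
  refine ⟨‖z‖ * R, ?_⟩
  rintro _ ⟨t, ht, rfl⟩
  refine (Complex.re_le_norm _).trans ?_
  rw [norm_mul]
  exact mul_le_mul_of_nonneg_left (hR t ht) (norm_nonneg z)

theorem re_mul_le_supportFn {S : Set ℂ} (hS : Bornology.IsBounded S) (z : ℂ) {t : ℂ}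
    (ht : t ∈ S) : (z * t).re ≤ supportFn S z :=
  le_csSup (bddAbove_re_mul_image hS z) ⟨t, ht, rfl⟩

theorem supportFn_mono {S T : Set ℂ} (hT : Bornology.IsBounded T) (hS : S.Nonempty)
    (hST : S ⊆ T) (z : ℂ) : supportFn S z ≤ supportFn T z :=
  csSup_le_csSup (bddAbove_re_mul_image hT z) (hS.image _) (image_mono hST)

/-- A half-plane `Re (z t) ≤ c` containing `S` contains its convex hull. -/
theorem exists_lt_re_mul_of_lt_supportFn_convexHull {S : Set ℂ} (hS : S.Nonempty) {z : ℂ} {c : ℝ}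
    (hc : c < supportFn (convexHull ℝ S) z) : ∃ t ∈ S, c < (z * t).re := by
  by_contra! hcon
  refine hc.not_ge (csSup_le (hS.convexHull.image _) ?_)
  have hconv : Convex ℝ {t : ℂ | (z * t).re ≤ c} :=
    convex_halfSpace_le (f := fun t : ℂ => (z * t).re)
      ⟨fun s t => by simp [mul_add], fun a t => by simp; ring⟩ c
  rintro _ ⟨t, ht, rfl⟩
  exact convexHull_min hcon hconv ht

/-- The relative boundary points of a set with a countable basis of neighbourhoods form a bounded
set. -/
theorem isBounded_inter_frontier_of_hasBasis {Q : Set ℂ} {U : ℕ → Set ℂ}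
    (hU : (𝓝ˢ Q).HasBasis (fun _ : ℕ => True) U) (hUo : ∀ n, IsOpen (U n)) :
    Bornology.IsBounded (Q ∩ frontier Q) := by
  -- If `ω` is unbounded, choose `w n ∈ ω` with norms tending to infinity and, next to each, a point
  -- `x n` of `U n` outside `Q`. The `x n` form a closed set, so its complement is a neighbourhood
  -- of `Q` that contains no `U n`.
  by_contra hb
  have hw : ∀ n : ℕ, ∃ w ∈ Q ∩ frontier Q, (n : ℝ) < ‖w‖ := by
    intro n
    by_contra! hcon
    exact hb (isBounded_iff_forall_norm_le.2 ⟨n, hcon⟩)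
  choose w hwQ hwn using hw
  have hx : ∀ n, ∃ x, x ∈ U n ∧ x ∉ Q ∧ dist x (w n) < 1 := fun n => by
    have hmem : w n ∈ closure Qᶜ := frontier_subset_closure (frontier_compl Q ▸ (hwQ n).2)
    have hUw : U n ∩ Metric.ball (w n) 1 ∈ 𝓝 (w n) :=
      inter_mem ((hUo n).mem_nhds (subset_of_mem_nhdsSet (hU.mem_of_mem trivial) (hwQ n).1))
        (Metric.ball_mem_nhds _ one_pos)
    obtain ⟨x, ⟨hxU, hxw⟩, hxQ⟩ := mem_closure_iff_nhds.1 hmem _ hUw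
    exact ⟨x, hxU, hxQ, hxw⟩
  choose x hxU hxQ hxw using hx
  have hxn : ∀ n : ℕ, (n : ℝ) - 1 ≤ ‖x n‖ := fun n => by
    have h1 := hwn n
    have h2 := hxw n
    have h3 := norm_sub_norm_le (w n) (x n)
    rw [dist_comm, dist_eq_norm] at h2
    linarith
  -- A sequence tending to infinity is a proper map from `ℕ`, so its range is closed.
  have hlim : Tendsto x cofinite (cocompact ℂ) := by
    rw [Nat.cofinite_eq_atTop, ← Metric.cobounded_eq_cocompact, ← tendsto_norm_atTop_iff_cobounded]
    exact tendsto_atTop_mono hxn (tendsto_atTop_add_const_right _ _ tendsto_natCast_atTop_atTop)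
  have hclosed : IsClosed (range x) := (isProperMap_iff_tendsto_cocompact.2
    ⟨continuous_of_discreteTopology, by rwa [cocompact_eq_cofinite]⟩).isClosedMap.isClosed_range
  have hnhds : (range x)ᶜ ∈ 𝓝ˢ Q := hclosed.isOpen_compl.mem_nhdsSet.2 <| by
    rintro y hy ⟨n, rfl⟩
    exact hxQ n hy
  obtain ⟨n, -, hn⟩ := hU.mem_iff.1 hnhds
  exact hn (hxU n) ⟨n, rfl⟩

/-! ### The splitting property of the functions `H_{nm}` -/

section Weights

variable {Q : Set ℂ} {G : ℕ → Set ℂ}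

theorem isBounded_compactHull (hω : Bornology.IsBounded (Q ∩ frontier Q))
    (hG : IsConvexCompactExhaustion (interior Q) G) (n m : ℕ) :
    Bornology.IsBounded (compactHull Q G n m) :=
  isBounded_convexHull.2 ((hG.isCompact m).isBounded.union
    (hω.add Metric.isBounded_closedBall))

theorem inter_frontier_subset_compactHull (Q : Set ℂ) (G : ℕ → Set ℂ) (n m : ℕ) :
    Q ∩ frontier Q ⊆ compactHull Q G n m := fun w hw =>
  subset_convexHull ℝ _ (Or.inr ⟨w, hw, 0, Metric.mem_closedBall_self (by positivity), add_zero w⟩)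

theorem compactHull_nonempty (hω : (Q ∩ frontier Q).Nonempty) (n m : ℕ) :
    (compactHull Q G n m).Nonempty :=
  hω.mono (inter_frontier_subset_compactHull Q G n m)

theorem weightFn_le_weightFn (hω : (Q ∩ frontier Q).Nonempty)
    (hωb : Bornology.IsBounded (Q ∩ frontier Q))
    (hG : IsConvexCompactExhaustion (interior Q) G) {n m n' m' : ℕ} (hm : m ≤ m')
    (hr : ((m : ℝ) + 1) / (((n : ℝ) + 1) * (1 + ((m : ℝ) + 1))) ≤
      ((m' : ℝ) + 1) / (((n' : ℝ) + 1) * (1 + ((m' : ℝ) + 1)))) (z : ℂ) :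
    weightFn Q G n m z ≤ weightFn Q G n' m' z := by
  refine supportFn_mono (isBounded_compactHull hωb hG _ _) (compactHull_nonempty hω _ _) ?_ z
  refine convexHull_mono (union_subset_union ?_ (add_subset_add_left ?_))
  · exact monotone_nat_of_le_succ
      (fun i => (hG.subset_interior_succ i).trans interior_subset) hm
  · exact Metric.closedBall_subset_closedBall hr

theorem isSplittingWeight_weightFn (hω : (Q ∩ frontier Q).Nonempty)
    (hωb : Bornology.IsBounded (Q ∩ frontier Q))
    (hG : IsConvexCompactExhaustion (interior Q) G) (ν : ℕ → ℂ) :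
    IsSplittingWeight fun n m j => weightFn Q G n m (ν j) where
  mono n j m m' hmm := by
    refine weightFn_le_weightFn hω hωb hG hmm ?_ _
    have hm : (m : ℝ) ≤ m' := Nat.cast_le.2 hmm
    rw [div_le_div_iff₀ (by positivity) (by positivity)]
    have hn : (0 : ℝ) ≤ (n : ℝ) + 1 := by positivity
    nlinarith [mul_le_mul_of_nonneg_left hm hn]
  anti m j n n' hnn := by
    refine weightFn_le_weightFn hω hωb hG le_rfl ?_ _
    gcongr
  bounded_below := by
    obtain ⟨w, hw⟩ := hω
    exact ⟨fun j => (ν j * w).re, fun n m j => re_mul_le_supportFn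
      (isBounded_compactHull hωb hG n m) _ (inter_frontier_subset_compactHull Q G n m hw)⟩
  split n := by
    -- With shifted indices this doubles `n + 1`. All radii of the new level are below `1 / (2 (n +
    -- 1))`, which is exactly the radius for the indices `n, 0`.
    refine ⟨2 * n + 1, fun m j => ?_⟩
    by_contra! hcon
    obtain ⟨h₁, k, h₂⟩ := hcon
    have hne : (G m ∪ ((Q ∩ frontier Q) + Metric.closedBall (0 : ℂ) (((m : ℝ) + 1) /
        ((((2 * n + 1 : ℕ) : ℝ) + 1) * (1 + ((m : ℝ) + 1)))))).Nonempty :=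
      convexHull_nonempty_iff.1 (compactHull_nonempty (G := G) hω (2 * n + 1) m)
    -- One point `t` of the union beats both weights. If `t ∈ G m`, it lies in the hull for `k, m`;
    -- otherwise it lies in that for `n, 0`. Either is a contradiction.
    obtain ⟨t, ht, hlt⟩ := exists_lt_re_mul_of_lt_supportFn_convexHull hne (max_lt h₁ h₂)
    rcases ht with ht | ht
    · exact ((le_max_right _ _).trans_lt hlt).not_ge (re_mul_le_supportFn
        (isBounded_compactHull hωb hG k m) _ (subset_convexHull ℝ _ (Or.inl ht)))
    · refine ((le_max_left _ _).trans_lt hlt).not_ge (re_mul_le_supportFn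
        (isBounded_compactHull hωb hG n 0) _ (subset_convexHull ℝ _ (Or.inr ?_)))
      refine add_subset_add_left (Metric.closedBall_subset_closedBall ?_) ht
      push_cast
      rw [div_le_div_iff₀ (by positivity) (by positivity)]
      have hn : (0 : ℝ) ≤ (n : ℝ) + 1 := by positivity
      nlinarith

end Weights

theorem mainTheorem6 (Q : Set ℂ) (hQconv : Convex ℝ Q) (hQint : (interior Q).Nonempty)
    (hQbasis : HasCountableConvexBasis Q) (hω : (Q ∩ frontier Q).Nonempty)
    (G : ℕ → Set ℂ) (hG : IsConvexCompactExhaustion (interior Q) G)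
    (K : Set ℂ) (hKconv : Convex ℝ K) (hKcomp : IsCompact K)
    (μ : AnalyticGerm K →L[ℂ] ℂ) (hμ : μ ≠ 0)
    (hzeros : {z : ℂ | laplaceTransform μ z = 0}.Infinite)
    (Ω : ℕ → Set ℂ) (hΩ : IsExceptionalSequence K (laplaceTransform μ) Ω)
    (ν : ℕ → ℂ) (hν : ∀ j, ν j ∈ Ω j ∧ laplaceTransform μ (ν j) = 0) :
    IsUltrabornological (LambdaSpace Q G (laplaceTransform μ) Ω ν) := by
  obtain ⟨U, hU, hUb⟩ := hQbasis
  have hωb := isBounded_inter_frontier_of_hasBasis hUb fun n => (hU n).1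
  have := fun j => completeSpace_boundedAnalytic (hΩ.isOpen j)
  exact isUltrabornological_projIndWeightedSeq (isSplittingWeight_weightFn hω hωb hG ν)
    (fun j => (multiplesIdeal (laplaceTransform μ) (Ω j)).mkQ)
    (fun j f => Submodule.Quotient.norm_mk_le _ f)
    (fun j x ε hε => Submodule.Quotient.norm_mk_lt x hε)
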